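/- Let $\{V_\hbar\}_{\hbar\in(0,1]}$ be real potentials on $\mathbb R^3$ and $\{A_\hbar\}_{\hbar\in(0,1]}$ self-adjoint operators on $L^2(\mathbb R^3)$ such that: (1) $V_\hbar\not\equiv0$ and $V_\hbar\le 0$; (2) $V_\hbar\in C^1$ and $\|V_\hbar\|_{L^{3,\infty}(\mathbb R^3)\cap C^1(\mathbb R^3)}$ is bounded uniformly in $\hbar\in(0,1]$ (where $L^{3,\infty}$ is weak $L^3$); (3) for some $E_1<0$, $\|(V_\hbar-\tfrac{E_1}{2})_-\|_{L^{3/2}(\mathbb R^3)}$ is bounded uniformly in $\hbar\in(0,1]$; (4) for some constant $K>0$, the Hilbert–Schmidt norms satisfy $\|A_\hbar\|_{\mathrm{HS}}\le K\sqrt\hbar$ for $\hbar\in(0,1]$. Here $x_+=\max\{x,0\}$ and $x_-=\min\{x,0\}$. Let $N^\hbar(E)$ be the number, counted with multiplicity, of eigenvalues strictly below $E$ of the operator $\sqrt{1-\hbar^2\Delta}-1+V_\hbar+A_\hbar$ on $L^2(\mathbb R^3)$. Then there is a universal constant $C>0$ such that for every $K>0$ and every $E_0<0$ there is $\hbar_0\in(0,1]$,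 depending only on $K$ and $E_0$, such that for all families satisfying (1)–(4) with this $K$, all $\hbar\in(0,\hbar_0]$ and all $E\le E_0$, $$(2\pi\hbar)^3N^\hbar(E)\le \frac{C}{\big(1-(1+\tfrac{E_0}{2})_+^2\big)^{3/2}}\,\big\|(\tfrac{E_0}{2}-V_\hbar)_+\big\|_{L^3(\mathbb R^3)}^3 .$$ -/

import Mathlib

open MeasureTheory Set
open scoped ENNReal FourierTransform

noncomputable section

/-- Three-dimensional Euclidean space. -/
abbrev R3 : Type := EuclideanSpace ℝ (Fin 3)

/-- The complex Hilbert space `L²(ℝ³)`. -/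
abbrev L2R3 : Type := Lp (α := R3) ℂ 2 volume

/-- The domain `{u ∈ L² : g u ∈ L²}` of the operator of multiplication by `g`. -/
def mulDomain (g : R3 → ℝ) : Submodule ℂ L2R3 where
  carrier := {u | MemLp (fun x => (g x : ℂ) * u x) 2 volume}
  add_mem' := by
    intro u v hu hv
    refine (memLp_congr_ae ?_).mpr (MemLp.add hu hv)
    filter_upwards [Lp.coeFn_add u v] with x hx
    simp only [hx, Pi.add_apply, mul_add]
  zero_mem' := by
    have h0 : MemLp (fun _ : R3 => (0 : ℂ)) 2 volume := MemLp.zero'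
    refine (memLp_congr_ae ?_).mpr h0
    filter_upwards [Lp.coeFn_zero ℂ 2 (volume : Measure R3)] with x hx
    simp only [hx, Pi.zero_apply, mul_zero]
  smul_mem' := by
    intro c u hu
    refine (memLp_congr_ae ?_).mpr (MemLp.const_smul hu c)
    filter_upwards [Lp.coeFn_smul c u] with x hx
    simp only [hx, Pi.smul_apply, smul_eq_mul]
    ring

/-- The product `g u ∈ L²` for `u` in the domain. -/
def mulFun (g : R3 → ℝ) (u : mulDomain g) : L2R3 :=
  MemLp.toLp (fun x => (g x : ℂ) * (u : L2R3) x) u.2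

theorem mulFun_coe (g : R3 → ℝ) (u : mulDomain g) :
    mulFun g u =ᵐ[volume] fun x => (g x : ℂ) * (u : L2R3) x :=
  MemLp.coeFn_toLp _

theorem mulFun_add (g : R3 → ℝ) (u v : mulDomain g) :
    mulFun g (u + v) = mulFun g u + mulFun g v := by
  refine Lp.ext ?_
  filter_upwards [Lp.coeFn_add (mulFun g u) (mulFun g v), Lp.coeFn_add (u : L2R3) (v : L2R3),
    mulFun_coe g u, mulFun_coe g v, mulFun_coe g (u + v)] with x h1 h2 h3 h4 h5
  rw [h5, h1, Pi.add_apply, h3, h4, Submodule.coe_add, h2, Pi.add_apply, mul_add]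

theorem mulFun_smul (g : R3 → ℝ) (c : ℂ) (u : mulDomain g) :
    mulFun g (c • u) = c • mulFun g u := by
  refine Lp.ext ?_
  filter_upwards [Lp.coeFn_smul c (mulFun g u), Lp.coeFn_smul c (u : L2R3),
    mulFun_coe g u, mulFun_coe g (c • u)] with x h1 h2 h3 h4
  rw [h4, h1, Pi.smul_apply, h3, Submodule.coe_smul, h2, Pi.smul_apply, smul_eq_mul, smul_eq_mul]
  ring

/-- The (maximal) operator of multiplication by `g` on `L²(ℝ³)`. -/
def mulOp (g : R3 → ℝ) : L2R3 →ₗ.[ℂ] L2R3 where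
  domain := mulDomain g
  toFun := { toFun := mulFun g, map_add' := mulFun_add g, map_smul' := mulFun_smul g }

/-- The Fourier multiplier `m(-i∇)` on `L²(ℝ³)`, for a real symbol `m` of the angular frequency:
`(m(-i∇)u)^ = m û` on the domain `{u ∈ L² : m û ∈ L²}`.
Mathlib's Fourier transform has kernel `exp (-2π i x·ξ)`, so that the angular frequency
that belongs to Mathlib's variable `ξ` is `2πξ`. -/
def fourierMultiplier (m : R3 → ℝ) : L2R3 →ₗ.[ℂ] L2R3 where
  domain := (mulOp fun ξ => m ((2 * Real.pi) • ξ)).domain.comap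
    (Lp.fourierTransformₗᵢ R3 ℂ).toLinearEquiv.toLinearMap
  toFun := (Lp.fourierTransformₗᵢ R3 ℂ).symm.toLinearEquiv.toLinearMap ∘ₗ
    (mulOp fun ξ => m ((2 * Real.pi) • ξ)).toFun ∘ₗ
    ((Lp.fourierTransformₗᵢ R3 ℂ).toLinearEquiv.toLinearMap.restrict fun _ h => h)

/-- The relativistic kinetic energy `√(1 - ℏ²Δ) - 1`. -/
def kineticOp (ℏ : ℝ) : L2R3 →ₗ.[ℂ] L2R3 :=
  fourierMultiplier fun p => Real.sqrt (1 + ℏ ^ 2 * ‖p‖ ^ 2) - 1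

/-- The operator `√(1 - ℏ²Δ) - 1 + V + A` on `L²(ℝ³)`. For bounded measurable `V` and `ℏ > 0`
its domain is the Sobolev space `H¹(ℝ³)`. -/
def hamiltonian (ℏ : ℝ) (V : R3 → ℝ) (A : L2R3 →L[ℂ] L2R3) : L2R3 →ₗ.[ℂ] L2R3 :=
  kineticOp ℏ + mulOp V + A.toLinearMap.toPMap ⊤

/-- The eigenspace `ker (T - μ)` of an operator `T` with a domain. -/
def eigenspaceOf (T : L2R3 →ₗ.[ℂ] L2R3) (μ : ℝ) : Submodule ℂ L2R3 :=
  (LinearMap.ker (T.toFun - (μ : ℂ) • T.domain.subtype)).map T.domain.subtype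

/-- The number of eigenvalues `μ < E` of `T`, counted with multiplicity (`∞` is allowed). -/
def eigenvalueCount (T : L2R3 →ₗ.[ℂ] L2R3) (E : ℝ) : ℝ≥0∞ :=
  ∑' μ : Iio E, ((Module.rank ℂ (eigenspaceOf T μ)).toENat : ℝ≥0∞)

/-- The number `N^ℏ(E; V, A)` of eigenvalues below `E` of `√(1 - ℏ²Δ) - 1 + V + A`. -/
def countingN (ℏ : ℝ) (V : R3 → ℝ) (A : L2R3 →L[ℂ] L2R3) (E : ℝ) : ℝ≥0∞ :=
  eigenvalueCount (hamiltonian ℏ V A) E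

/-- The Hilbert-Schmidt norm `(∑ ‖A eᵢ‖²)^{1/2}`, `(eᵢ)` an orthonormal basis of `L²(ℝ³)`.
The sum is the same for all orthonormal bases; instead of choosing one, take the supremum. -/
def hsNorm (A : L2R3 →L[ℂ] L2R3) : ℝ≥0∞ :=
  (⨆ (w : Set L2R3) (b : HilbertBasis w ℂ L2R3), ∑' i, ‖A (b i)‖ₑ ^ 2) ^ (1 / 2 : ℝ)

/-- The weak `L³` (quasi)norm `sup_{t > 0} t |{|f| > t}|^{1/3}`. -/
def weakL3Norm (f : R3 → ℝ) : ℝ≥0∞ :=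
  ⨆ (t : ℝ) (_ : 0 < t), ENNReal.ofReal t * volume {x | t < |f x|} ^ (1 / 3 : ℝ)

/-- The standing assumptions on a family of potentials `V ℏ` and of self-adjoint operators `A ℏ`,
`0 < ℏ ≤ 1`, where `K` is the constant in `‖A ℏ‖_HS = O(√ℏ)`. -/
structure WeylAssumption (K : ℝ) (V : ℝ → R3 → ℝ) (A : ℝ → L2R3 →L[ℂ] L2R3) : Prop where
  ne_zero : ∀ ℏ ∈ Ioc (0 : ℝ) 1, V ℏ ≠ 0
  nonpos : ∀ ℏ ∈ Ioc (0 : ℝ) 1, ∀ x, V ℏ x ≤ 0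
  contDiff : ∀ ℏ ∈ Ioc (0 : ℝ) 1, ContDiff ℝ 1 (V ℏ)
  bounded_C1 : ∃ M : ℝ, ∀ ℏ ∈ Ioc (0 : ℝ) 1, ∀ x, |V ℏ x| ≤ M ∧ ‖fderiv ℝ (V ℏ) x‖ ≤ M
  bounded_weakL3 : ∃ M : ℝ, ∀ ℏ ∈ Ioc (0 : ℝ) 1, weakL3Norm (V ℏ) ≤ ENNReal.ofReal M
  bounded_negPart : ∃ E₁ : ℝ, E₁ < 0 ∧ ∃ M : ℝ, ∀ ℏ ∈ Ioc (0 : ℝ) 1,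
    eLpNorm (fun x => min (V ℏ x - E₁ / 2) 0) (3 / 2) volume ≤ ENNReal.ofReal M
  selfAdjoint : ∀ ℏ ∈ Ioc (0 : ℝ) 1, IsSelfAdjoint (A ℏ)
  hsNorm_le : ∀ ℏ ∈ Ioc (0 : ℝ) 1, hsNorm (A ℏ) ≤ ENNReal.ofReal (K * Real.sqrt ℏ)

end

/-! The estimate is a Cwikel-Lieb-Rozenblum bound for `|p|`. For `ℏ ≤ ℏ₀` the Hilbert-Schmidt bound
gives `‖A‖ ≤ |E₀|/4`, and `√(1 + q²) - 1` lies above the line `√(1 - (1 + E₀/4)₊²) q + E₀/4`. Hence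
on the span of eigenvectors below `E ≤ E₀` the form `κ|ξ| - (E₀/2 - V)₊` is nonpositive, where `κ =
2πℏ √(1 - (1 + E₀/4)₊²)` (`energy_estimate`). Of the spectral gap `|E₀|`, one quarter pays for `A`,
one for the line, and half stays with `V`.

The dimension `n` of such a space is bounded by Rumin's method. Choose a basis `uᵢ` for which the
functions `|ξ|^{1/2} ûᵢ` are orthonormal. Bessel's inequality bounds the density of the frequencies
`|ξ| ≤ t` pointwise by `c t²`, so where `∑ |uᵢ|²` exceeds `4 c t²` it is controlled by the high
frequencies. Summing over `t = 2^k` recovers `∑ ∫ |ξ| |ûᵢ|² = n` and gives `∫ W ∑ |uᵢ|² ≤ 8n/a + 16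
c a² ∫ W³` for every `a > 0` (`lintegral_mul_density_le`). A suitable `a` lets half of `κ n` be
absorbed (`card_le_of_energy_le`). -/

/-! ### Fourier and `L²` preliminaries. -/

/-- On `L¹ ∩ L²` the inverse Fourier transform of `L²` is given by the Fourier integral. -/
theorem fourierTransformₗᵢ_symm_ae_eq (h : L2R3) (hi : Integrable (h : R3 → ℂ)) :
    ((Lp.fourierTransformₗᵢ R3 ℂ).symm h : L2R3) =ᵐ[volume] 𝓕⁻ (h : R3 → ℂ) := by
  have hneg : 𝓕⁻ (h : R3 → ℂ) = fun x => 𝓕 (h : R3 → ℂ) (-x) := by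
    ext x; rw [Real.fourierInv_eq_fourier_neg]
  have hcont : Continuous (𝓕⁻ (h : R3 → ℂ)) := by
    rw [hneg]
    exact (VectorFourier.fourierIntegral_continuous Real.continuous_fourierChar
      (by simpa using continuous_inner) hi).comp continuous_neg
  refine ae_eq_of_integral_contDiff_smul_eq ((Lp.memLp _).locallyIntegrable one_le_two)
    hcont.locallyIntegrable ?_
  intro g g_smooth g_cpt
  have hg₁ : HasCompactSupport (Complex.ofRealCLM ∘ g) := g_cpt.comp_left rfl
  have hg₂ : ContDiff ℝ (⊤ : ℕ∞) (Complex.ofRealCLM ∘ g) := by fun_prop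
  let G : SchwartzMap R3 ℂ := hg₁.toSchwartzMap hg₂
  have hG : ∀ x, G x = (g x : ℂ) := fun x => rfl
  -- The `L²` transform agrees with the distributional one, which acts by transforming the test
  -- function.
  have key := Lp.fourierInv_toTemperedDistribution_eq h
  have key2 : ∫ x, (𝓕⁻ G) x • h x = ∫ x, G x • ((Lp.fourierTransformₗᵢ R3 ℂ).symm h : L2R3) x := by
    have := congrArg (fun D => D G) key
    simp only [TemperedDistribution.fourierInv_apply, Lp.toTemperedDistribution_apply] at this
    exact this
  have e1 : ∀ x, (𝓕⁻ G) x = 𝓕 (fun y => G (-y)) x := by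
    intro x
    rw [SchwartzMap.fourierInv_coe, Real.fourierInv_eq_fourier_comp_neg]
  -- Fubini moves the integral transform from `G` to `h`; the reflection turns `𝓕⁻` into `𝓕` and is
  -- undone by `x ↦ -x`.
  have key3 : ∫ x, (𝓕⁻ G) x • h x = ∫ x, G x • 𝓕⁻ (h : R3 → ℂ) x := by
    simp_rw [e1]
    have := VectorFourier.integral_fourierIntegral_smul_eq_flip (μ := volume) (ν := volume)
      (L := innerₗ R3) Real.continuous_fourierChar (by simpa using continuous_inner)
      (G.integrable.comp_neg) hi
    rw [flip_innerₗ] at this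
    refine this.trans ?_
    rw [← integral_neg_eq_self]
    simp only [neg_neg, hneg]
    rfl
  calc ∫ x, g x • ((Lp.fourierTransformₗᵢ R3 ℂ).symm h : L2R3) x
      = ∫ x, G x • ((Lp.fourierTransformₗᵢ R3 ℂ).symm h : L2R3) x := by simp [hG]
    _ = ∫ x, G x • 𝓕⁻ (h : R3 → ℂ) x := by rw [← key2, key3]
    _ = _ := by simp [hG]

/-- `∫_{|ξ| ≤ t} |ξ|⁻¹ dξ = lowFreqConst * t²`. -/
noncomputable def lowFreqConst : ℝ := 3 / 2 * volume.real (Metric.ball (0 : R3) 1)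

theorem lowFreqConst_pos : 0 < lowFreqConst := by
  unfold lowFreqConst
  have : 0 < volume.real (Metric.ball (0 : R3) 1) :=
    ENNReal.toReal_pos (Metric.measure_ball_pos _ _ one_pos).ne' measure_ball_lt_top.ne
  positivity

theorem integral_indicator_inv_norm {t : ℝ} (ht : 0 < t) :
    Integrable (fun ξ : R3 => (Iic t).indicator (fun s : ℝ => s⁻¹) ‖ξ‖) ∧
    ∫ ξ : R3, (Iic t).indicator (fun s : ℝ => s⁻¹) ‖ξ‖ = lowFreqConst * t ^ 2 := by
  have e : ∀ y ∈ Ioi (0 : ℝ), y ^ (Module.finrank ℝ R3 - 1) • (Iic t).indicator (fun s : ℝ => s⁻¹) y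
      = (Iic t).indicator (fun s : ℝ => s) y := by
    intro y hy
    have hy' : y ≠ 0 := ne_of_gt hy
    by_cases h : y ≤ t
    · simp [h]; field_simp
    · simp [h]
  have e2 : IntegrableOn (fun s : ℝ => s) (Ioc 0 t) :=
    (continuous_id.integrableOn_Icc).mono_set Ioc_subset_Icc_self
  constructor
  · rw [integrable_fun_norm_addHaar volume (f := (Iic t).indicator (fun s : ℝ => s⁻¹)),
      integrableOn_congr_fun e measurableSet_Ioi, IntegrableOn,
      integrable_indicator_iff measurableSet_Iic, IntegrableOn,
      Measure.restrict_restrict measurableSet_Iic, inter_comm, Ioi_inter_Iic]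
    exact e2
  · rw [integral_fun_norm_addHaar volume (f := (Iic t).indicator (fun s : ℝ => s⁻¹)),
      setIntegral_congr_fun measurableSet_Ioi e, setIntegral_indicator measurableSet_Iic,
      Ioi_inter_Iic, ← intervalIntegral.integral_of_le ht.le, integral_id]
    simp [lowFreqConst]
    ring

theorem enorm_sq_eq_lintegral (u : L2R3) : ‖u‖ₑ ^ 2 = ∫⁻ x, ‖u x‖ₑ ^ 2 := by
  rw [Lp.enorm_def, eLpNorm_eq_lintegral_rpow_enorm_toReal two_ne_zero ENNReal.ofNat_ne_top,
    ← ENNReal.rpow_natCast, ← ENNReal.rpow_mul]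
  simp

theorem norm_sq_eq_integral (u : L2R3) : ‖u‖ ^ 2 = ∫ x, ‖u x‖ ^ 2 := by
  have := L2.inner_def (𝕜 := ℂ) u u
  rw [inner_self_eq_norm_sq_to_K] at this
  simp only [inner_self_eq_norm_sq_to_K] at this
  norm_cast at this

theorem integrable_norm_sq (u : L2R3) : Integrable fun x => ‖u x‖ ^ 2 :=
  (Lp.memLp u).integrable_norm_pow two_ne_zero

/-! ### Splitting the density by frequency. -/

/-- Bessel's inequality for the low-frequency parts: if the functions `|ξ|^{1/2} hᵢ` are
orthonormal, the truncations of `hᵢ` to `|ξ| ≤ t` have inverse Fourier transforms whose squares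
add up to at most `∫_{|ξ| ≤ t} |ξ|⁻¹`. -/
theorem sum_norm_sq_fourierInv_indicator_le {ι : Type*} [Fintype ι] {φ h : ι → L2R3}
    (hφ : Orthonormal ℂ φ) (hh : ∀ i, φ i =ᵐ[volume] fun ξ => (√‖ξ‖ : ℂ) * h i ξ)
    {t : ℝ} (ht : 0 < t) (x : R3) :
    ∑ i, ‖𝓕⁻ ((Metric.closedBall (0 : R3) t).indicator (h i : R3 → ℂ)) x‖ ^ 2
      ≤ lowFreqConst * t ^ 2 := by
  -- Pairing with `g` cancels the weight `|ξ|^{1/2}` in `φ i` and leaves the truncated inversion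
  -- integral at `x`. The weight cannot be cancelled at `ξ = 0`, a null set.
  let g : R3 → ℂ := (Metric.closedBall (0 : R3) t).indicator fun ξ =>
    ((√‖ξ‖)⁻¹ : ℂ) * Complex.exp (((-2 * Real.pi * inner ℝ ξ x : ℝ) : ℂ) * Complex.I)
  have hgm : Measurable g := by
    refine Measurable.indicator ?_ Metric.isClosed_closedBall.measurableSet
    fun_prop
  have hgn : ∀ ξ, ‖g ξ‖ ^ 2 = (Iic t).indicator (fun s : ℝ => s⁻¹) ‖ξ‖ := by
    intro ξ
    by_cases hξ : ‖ξ‖ ≤ t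
    · have : ξ ∈ Metric.closedBall (0 : R3) t := by simpa using hξ
      simp only [g, indicator_of_mem this, norm_mul, Complex.norm_exp_ofReal_mul_I, mul_one]
      rw [indicator_of_mem (by exact hξ), ← Complex.ofReal_inv, Complex.norm_real, norm_inv,
        inv_pow, Real.norm_eq_abs, sq_abs, Real.sq_sqrt (norm_nonneg _)]
    · have : ξ ∉ Metric.closedBall (0 : R3) t := by simpa using hξ
      simp only [g, indicator_of_notMem this]
      rw [indicator_of_notMem (by exact hξ)]
      simp
  obtain ⟨hint, hval⟩ := integral_indicator_inv_norm ht
  have hgL : MemLp g 2 := by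
    rw [memLp_two_iff_integrable_sq_norm hgm.aestronglyMeasurable]
    simpa only [hgn] using hint
  have hnorm : ‖hgL.toLp g‖ ^ 2 = lowFreqConst * t ^ 2 := by
    rw [norm_sq_eq_integral, ← hval]
    refine integral_congr_ae ?_
    filter_upwards [hgL.coeFn_toLp] with ξ hξ
    rw [hξ, hgn]
  have hin : ∀ i, 𝓕⁻ ((Metric.closedBall (0 : R3) t).indicator (h i : R3 → ℂ)) x
      = inner ℂ (hgL.toLp g) (φ i) := by
    intro i
    rw [L2.inner_def, Real.fourierInv_eq']
    refine integral_congr_ae ?_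
    have h0 : ∀ᵐ ξ : R3, ξ ≠ 0 := by simp [ae_iff]
    filter_upwards [hgL.coeFn_toLp, hh i, h0] with ξ h1 h2 h3
    rw [h1, h2, RCLike.inner_apply]
    by_cases hξ : ξ ∈ Metric.closedBall (0 : R3) t
    · have h4 : ((√‖ξ‖ : ℝ) : ℂ) ≠ 0 := by
        simpa using h3
      simp only [g, indicator_of_mem hξ, map_mul, map_inv₀, Complex.conj_ofReal, ← Complex.exp_conj,
        Complex.conj_I, smul_eq_mul]
      have h5 : -(((-2 * Real.pi * inner ℝ ξ x : ℝ) : ℂ) * Complex.I)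
          = ((2 * Real.pi * inner ℝ ξ x : ℝ) : ℂ) * Complex.I := by
        push_cast; ring
      rw [mul_neg, h5]
      field_simp
    · simp [g, indicator_of_notMem hξ]
  calc _ = ∑ i, ‖inner ℂ (φ i) (hgL.toLp g)‖ ^ 2 := by
        refine Finset.sum_congr rfl fun i _ => ?_
        rw [hin, norm_inner_symm]
    _ ≤ ‖hgL.toLp g‖ ^ 2 := hφ.sum_inner_products_le _
    _ = _ := hnorm

/-- The density `∑ |uᵢ|²` can be large only where the high-frequency parts contribute. -/
theorem setLIntegral_density_le {ι : Type*} [Fintype ι] {φ h u : ι → L2R3}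
    (hφ : Orthonormal ℂ φ) (hh : ∀ i, φ i =ᵐ[volume] fun ξ => (√‖ξ‖ : ℂ) * h i ξ)
    (hu : ∀ i, Lp.fourierTransformₗᵢ R3 ℂ (u i) = h i) {t : ℝ} (ht : 0 < t) :
    ∫⁻ x in {x | 4 * lowFreqConst * t ^ 2 ≤ ∑ i, ‖u i x‖ ^ 2}, ENNReal.ofReal (∑ i, ‖u i x‖ ^ 2)
      ≤ 4 * ∑ i, ∫⁻ ξ in {ξ | t < ‖ξ‖}, ‖h i ξ‖ₑ ^ 2 := by
  set B := Metric.closedBall (0 : R3) t with hB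
  have hBm : MeasurableSet B := Metric.isClosed_closedBall.measurableSet
  have hlowL : ∀ i, MemLp (B.indicator (h i : R3 → ℂ)) 2 := fun i => (Lp.memLp (h i)).indicator hBm
  let low : ι → L2R3 := fun i => (hlowL i).toLp _
  have hlow : ∀ i, (low i : R3 → ℂ) =ᵐ[volume] B.indicator (h i : R3 → ℂ) :=
    fun i => (hlowL i).coeFn_toLp
  have hlowi : ∀ i, Integrable (low i : R3 → ℂ) := by
    intro i
    refine Integrable.congr ?_ (hlow i).symm
    rw [integrable_indicator_iff hBm]
    have : IsFiniteMeasure (volume.restrict B) := ⟨by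
      simpa using (isCompact_closedBall (0 : R3) t).measure_lt_top⟩
    exact ((Lp.memLp (h i)).restrict B).integrable one_le_two
  -- The high-frequency part of `u i`; Plancherel gives its norm.
  let v : ι → L2R3 := fun i => (Lp.fourierTransformₗᵢ R3 ℂ).symm (h i - low i)
  have hv : ∀ i, ∫⁻ x, ‖v i x‖ₑ ^ 2 = ∫⁻ ξ in {ξ | t < ‖ξ‖}, ‖h i ξ‖ₑ ^ 2 := by
    intro i
    rw [← enorm_sq_eq_lintegral, LinearIsometryEquiv.enorm_map, enorm_sq_eq_lintegral,
      ← lintegral_indicator (measurableSet_lt measurable_const measurable_norm)]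
    refine lintegral_congr_ae ?_
    filter_upwards [Lp.coeFn_sub (h i) (low i), hlow i] with ξ h1 h2
    rw [h1, Pi.sub_apply, h2]
    by_cases hξ : ‖ξ‖ ≤ t
    · have h3 : ξ ∈ B := by simpa [hB] using hξ
      have h4 : ξ ∉ {ξ : R3 | t < ‖ξ‖} := by simpa using hξ
      simp [indicator_of_mem h3, indicator_of_notMem h4]
    · have h3 : ξ ∉ B := by simpa [hB] using hξ
      have h4 : ξ ∈ {ξ : R3 | t < ‖ξ‖} := by simpa using hξ
      simp [indicator_of_notMem h3, indicator_of_mem h4]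
  have huv : ∀ᵐ x, ∀ i, u i x = v i x + 𝓕⁻ (B.indicator (h i : R3 → ℂ)) x := by
    rw [ae_all_iff]
    intro i
    have e : u i = v i + (Lp.fourierTransformₗᵢ R3 ℂ).symm (low i) := by
      rw [← map_add, sub_add_cancel, ← hu i, LinearIsometryEquiv.symm_apply_apply]
    rw [e]
    filter_upwards [Lp.coeFn_add (v i) ((Lp.fourierTransformₗᵢ R3 ℂ).symm (low i)),
      fourierTransformₗᵢ_symm_ae_eq (low i) (hlowi i)] with x h1 h2
    rw [h1, Pi.add_apply, h2, Real.fourierInv_congr_ae (hlow i)]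
  have hm : MeasurableSet {x | 4 * lowFreqConst * t ^ 2 ≤ ∑ i, ‖u i x‖ ^ 2} := by
    refine measurableSet_le measurable_const (Finset.measurable_sum _ fun i _ => ?_)
    exact (Lp.stronglyMeasurable (u i)).measurable.norm.pow_const 2
  calc _ ≤ ∫⁻ x, 4 * ∑ i, ‖v i x‖ₑ ^ 2 := by
        rw [← lintegral_indicator hm]
        refine lintegral_mono_ae ?_
        filter_upwards [huv] with x hx
        by_cases hmem : x ∈ {x | 4 * lowFreqConst * t ^ 2 ≤ ∑ i, ‖u i x‖ ^ 2}
        swap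
        · simp [indicator_of_notMem hmem]
        rw [indicator_of_mem hmem]
        have h1 := sum_norm_sq_fourierInv_indicator_le hφ hh ht x
        have h2 : ∑ i, ‖u i x‖ ^ 2 ≤ 2 * ∑ i, ‖v i x‖ ^ 2
            + 2 * ∑ i, ‖𝓕⁻ (B.indicator (h i : R3 → ℂ)) x‖ ^ 2 := by
          rw [Finset.mul_sum, Finset.mul_sum, ← Finset.sum_add_distrib]
          refine Finset.sum_le_sum fun i _ => ?_
          rw [hx i]
          have := norm_add_le (v i x) (𝓕⁻ (B.indicator (h i : R3 → ℂ)) x)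
          have h3 := norm_nonneg (v i x + 𝓕⁻ (B.indicator (h i : R3 → ℂ)) x)
          nlinarith [sq_nonneg (‖v i x‖ - ‖𝓕⁻ (B.indicator (h i : R3 → ℂ)) x‖)]
        -- The low frequencies contribute at most `2 c t²`, half of the density on this set, and are
        -- absorbed.
        have h3 : ∑ i, ‖u i x‖ ^ 2 ≤ 4 * ∑ i, ‖v i x‖ ^ 2 := by
          have : 4 * lowFreqConst * t ^ 2 ≤ ∑ i, ‖u i x‖ ^ 2 := hmem
          linarith
        refine (ENNReal.ofReal_le_ofReal h3).trans_eq ?_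
        rw [ENNReal.ofReal_mul (by norm_num), ENNReal.ofReal_sum_of_nonneg (fun _ _ => by positivity)]
        simp [ENNReal.ofReal_pow]
    _ = _ := by
        rw [lintegral_const_mul' _ _ (by simp), lintegral_finsetSum]
        · simp_rw [hv]
        · exact fun i _ => (Lp.stronglyMeasurable (v i)).measurable.enorm.pow_const 2

/-! ### Dyadic summation over the frequency cutoff. -/

theorem sum_zpow_le_of_forall_le (S : Finset ℤ) :
    ∀ m : ℤ, (∀ k ∈ S, k ≤ m) → ∑ k ∈ S, (2 : ℝ) ^ k ≤ 2 ^ (m + 1) := by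
  induction S using Finset.induction_on_max with
  | empty => intro m _; simp; positivity
  | insert a S hS ih =>
    intro m hm
    rw [Finset.sum_insert fun h => (hS a h).false]
    have h1 := ih (a - 1) fun k hk => Int.le_sub_one_of_lt (hS k hk)
    rw [sub_add_cancel] at h1
    have h2 : (2 : ℝ) ^ (a + 1) ≤ 2 ^ (m + 1) :=
      zpow_le_zpow_right₀ one_le_two (by have := hm a (by simp); omega)
    rw [zpow_add_one₀ two_ne_zero] at h2
    linarith

theorem tsum_indicator_zpow_le (s : ℝ) :
    ∑' k : ℤ, (if (2 : ℝ) ^ k < s then ENNReal.ofReal ((2 : ℝ) ^ k) else 0)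
      ≤ ENNReal.ofReal (2 * s) := by
  refine ENNReal.summable.tsum_le_of_sum_le fun S => ?_
  rw [← Finset.sum_filter, ← ENNReal.ofReal_sum_of_nonneg (fun _ _ => by positivity)]
  rcases le_or_gt s 0 with hs | hs
  · rw [Finset.filter_false_of_mem]
    · simp
    · exact fun k _ => not_lt.2 (hs.trans (by positivity))
  obtain ⟨m, hm1, hm2⟩ := exists_mem_Ioc_zpow hs one_lt_two
  refine ENNReal.ofReal_le_ofReal ((sum_zpow_le_of_forall_le _ m ?_).trans ?_)
  · intro k hk
    have := (Finset.mem_filter.1 hk).2.trans_le hm2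
    have := (zpow_lt_zpow_iff_right₀ (one_lt_two (α := ℝ))).1 this
    omega
  · rw [zpow_add_one₀ two_ne_zero]; linarith

/-- After exchanging sum and integral, each `ξ` carries the geometric sum of all `2^k < |ξ|`, which
is at most `2|ξ|`. -/
theorem tsum_zpow_mul_setLIntegral_le {f : R3 → ℝ≥0∞} (hf : Measurable f) :
    ∑' k : ℤ, ENNReal.ofReal ((2 : ℝ) ^ k) * ∫⁻ ξ in {ξ | (2 : ℝ) ^ k < ‖ξ‖}, f ξ
      ≤ 2 * ∫⁻ ξ, ENNReal.ofReal ‖ξ‖ * f ξ := by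
  have e : ∀ k : ℤ, ENNReal.ofReal ((2 : ℝ) ^ k) * ∫⁻ ξ in {ξ | (2 : ℝ) ^ k < ‖ξ‖}, f ξ
      = ∫⁻ ξ, (if (2 : ℝ) ^ k < ‖ξ‖ then ENNReal.ofReal ((2 : ℝ) ^ k) else 0) * f ξ := by
    intro k
    rw [← lintegral_const_mul _ hf,
      ← lintegral_indicator (measurableSet_lt measurable_const measurable_norm)]
    refine lintegral_congr fun ξ => ?_
    by_cases hξ : (2 : ℝ) ^ k < ‖ξ‖ <;> simp [indicator, hξ]
  simp_rw [e]
  rw [← lintegral_tsum, ← lintegral_const_mul']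
  · refine lintegral_mono fun ξ => ?_
    rw [ENNReal.tsum_mul_right, ← mul_assoc]
    gcongr
    refine (tsum_indicator_zpow_le _).trans_eq ?_
    rw [ENNReal.ofReal_mul (by norm_num)]; simp
  · simp
  · refine fun k => (Measurable.mul ?_ hf).aemeasurable
    exact Measurable.ite (measurableSet_lt measurable_const measurable_norm) measurable_const
      measurable_const

theorem sum_lintegral_norm_mul_enorm_sq {ι : Type*} [Fintype ι] {φ h : ι → L2R3}
    (hφ : Orthonormal ℂ φ) (hh : ∀ i, φ i =ᵐ[volume] fun ξ => (√‖ξ‖ : ℂ) * h i ξ) :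
    ∑ i, ∫⁻ ξ, ENNReal.ofReal ‖ξ‖ * ‖h i ξ‖ₑ ^ 2 = Fintype.card ι := by
  have : ∀ i, ∫⁻ ξ, ENNReal.ofReal ‖ξ‖ * ‖h i ξ‖ₑ ^ 2 = 1 := by
    intro i
    have h1 : ‖φ i‖ₑ ^ 2 = 1 := by
      rw [← ofReal_norm, hφ.1 i]; simp
    rw [← h1, enorm_sq_eq_lintegral]
    refine lintegral_congr_ae ?_
    filter_upwards [hh i] with ξ hξ
    rw [hξ, enorm_mul, mul_pow, ← ofReal_norm (Complex.ofReal _), ← ENNReal.ofReal_pow (norm_nonneg _),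
      Complex.norm_real, Real.norm_eq_abs, sq_abs, Real.sq_sqrt (norm_nonneg _)]
  rw [Finset.sum_congr rfl fun i _ => this i]
  simp

/-! ### The Cwikel-Lieb-Rozenblum bound for orthonormal systems. -/

/-- A weighted Rumin-type inequality for functions that are orthonormal with respect to
`⟨u, |ξ| u⟩`. -/
theorem lintegral_mul_density_le {ι : Type*} [Fintype ι] {φ h u : ι → L2R3}
    (hφ : Orthonormal ℂ φ) (hh : ∀ i, φ i =ᵐ[volume] fun ξ => (√‖ξ‖ : ℂ) * h i ξ)
    (hu : ∀ i, Lp.fourierTransformₗᵢ R3 ℂ (u i) = h i) {a : ℝ} (ha : 0 < a) {W : R3 → ℝ}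
    (hW : Measurable W) (hW0 : ∀ x, 0 ≤ W x) :
    ∫⁻ x, ENNReal.ofReal (W x * ∑ i, ‖u i x‖ ^ 2) ≤ ENNReal.ofReal (8 / a) * Fintype.card ι
      + ENNReal.ofReal (16 * lowFreqConst * a ^ 2) * ∫⁻ x, ENNReal.ofReal (W x ^ 3) := by
  have hc := lowFreqConst_pos
  set ρ : R3 → ℝ := fun x => ∑ i, ‖u i x‖ ^ 2 with hρ
  have hρ0 : ∀ x, 0 ≤ ρ x := fun x => Finset.sum_nonneg fun i _ => by positivity
  have hρm : Measurable ρ := Finset.measurable_sum _ fun i _ =>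
    (Lp.stronglyMeasurable (u i)).measurable.norm.pow_const 2
  let S : ℤ → Set R3 := fun k => {x | 4 * lowFreqConst * ((2 : ℝ) ^ k) ^ 2 ≤ ρ x}
  have hS : ∀ k, MeasurableSet (S k) := fun k => measurableSet_le measurable_const hρm
  have hpt : ∀ x, ENNReal.ofReal (W x * ρ x) ≤ ENNReal.ofReal (1 / a) *
      ∑' k : ℤ, ENNReal.ofReal ((2 : ℝ) ^ k) * (S k).indicator (fun y => ENNReal.ofReal (ρ y)) x
      + ENNReal.ofReal (16 * lowFreqConst * a ^ 2) * ENNReal.ofReal (W x ^ 3) := by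
    intro x
    rcases (hW0 x).eq_or_lt with h0 | h0
    · simp [← h0]
    -- With `2^m < a W x ≤ 2^(m+1)`, a density above the threshold of level `m + 1` is paid by that
    -- single term of the sum, and a smaller one is at most `16 c (a W x)²`.
    obtain ⟨m, hm1, hm2⟩ := exists_mem_Ioc_zpow (mul_pos ha h0) one_lt_two
    rw [zpow_add_one₀ two_ne_zero] at hm2
    by_cases hx : x ∈ S (m + 1)
    · refine le_add_right ?_
      refine le_trans ?_ (mul_le_mul_right (ENNReal.le_tsum (m + 1)) _)
      rw [indicator_of_mem hx, ← ENNReal.ofReal_mul (by positivity),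
        ← ENNReal.ofReal_mul (by positivity)]
      refine ENNReal.ofReal_le_ofReal ?_
      rw [zpow_add_one₀ two_ne_zero, ← mul_assoc]
      refine mul_le_mul_of_nonneg_right ?_ (hρ0 x)
      rw [one_div, inv_mul_eq_div, le_div_iff₀ ha]
      linarith
    · refine le_add_left ?_
      rw [← ENNReal.ofReal_mul (by positivity)]
      refine ENNReal.ofReal_le_ofReal ?_
      have h1 : ρ x < 4 * lowFreqConst * ((2 : ℝ) ^ (m + 1)) ^ 2 := not_le.1 hx
      rw [zpow_add_one₀ two_ne_zero] at h1
      have h2 : ((2 : ℝ) ^ m) ^ 2 ≤ (a * W x) ^ 2 := by gcongr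
      have h3 : ρ x ≤ 16 * lowFreqConst * (a * W x) ^ 2 := by nlinarith
      calc W x * ρ x ≤ W x * (16 * lowFreqConst * (a * W x) ^ 2) := by gcongr
        _ = _ := by ring
  have hind : ∀ k, Measurable ((S k).indicator fun y => ENNReal.ofReal (ρ y)) := fun k =>
    hρm.ennreal_ofReal.indicator (hS k)
  calc _ ≤ ∫⁻ x, (ENNReal.ofReal (1 / a) *
      ∑' k : ℤ, ENNReal.ofReal ((2 : ℝ) ^ k) * (S k).indicator (fun y => ENNReal.ofReal (ρ y)) x
      + ENNReal.ofReal (16 * lowFreqConst * a ^ 2) * ENNReal.ofReal (W x ^ 3)) := lintegral_mono hpt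
    _ = ENNReal.ofReal (1 / a) * ∑' k : ℤ, ENNReal.ofReal ((2 : ℝ) ^ k) *
          (∫⁻ x in S k, ENNReal.ofReal (ρ x))
        + ENNReal.ofReal (16 * lowFreqConst * a ^ 2) * ∫⁻ x, ENNReal.ofReal (W x ^ 3) := by
      rw [lintegral_add_right _ ((hW.pow_const 3).ennreal_ofReal.const_mul _),
        lintegral_const_mul' _ _ ENNReal.ofReal_ne_top,
        lintegral_const_mul' _ _ ENNReal.ofReal_ne_top,
        lintegral_tsum fun k => ((hind k).const_mul _).aemeasurable]
      simp_rw [lintegral_const_mul' _ _ ENNReal.ofReal_ne_top, lintegral_indicator (hS _)]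
    _ ≤ ENNReal.ofReal (1 / a) * ∑' k : ℤ, ENNReal.ofReal ((2 : ℝ) ^ k) *
          (4 * ∑ i, ∫⁻ ξ in {ξ | (2 : ℝ) ^ k < ‖ξ‖}, ‖h i ξ‖ₑ ^ 2)
        + ENNReal.ofReal (16 * lowFreqConst * a ^ 2) * ∫⁻ x, ENNReal.ofReal (W x ^ 3) := by
      gcongr with k
      exact setLIntegral_density_le hφ hh hu (by positivity)
    _ ≤ ENNReal.ofReal (1 / a) * (4 * (2 * (Fintype.card ι : ℝ≥0∞)))
        + ENNReal.ofReal (16 * lowFreqConst * a ^ 2) * ∫⁻ x, ENNReal.ofReal (W x ^ 3) := by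
      gcongr
      simp_rw [mul_left_comm _ (4 : ℝ≥0∞)]
      rw [ENNReal.tsum_mul_left]
      refine mul_le_mul_right ?_ 4
      simp_rw [Finset.mul_sum]
      rw [Summable.tsum_finsetSum fun _ _ => ENNReal.summable,
        ← sum_lintegral_norm_mul_enorm_sq hφ hh, Finset.mul_sum]
      exact Finset.sum_le_sum fun i _ => tsum_zpow_mul_setLIntegral_le
        ((Lp.stronglyMeasurable (h i)).measurable.enorm.pow_const 2)
    _ = _ := by
      congr 1
      rw [← mul_assoc, ← mul_assoc, mul_assoc (ENNReal.ofReal _), div_eq_mul_one_div 8 a,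
        ENNReal.ofReal_mul (by norm_num), mul_comm (ENNReal.ofReal 8)]
      norm_num

/-- The Cwikel-Lieb-Rozenblum inequality for `|p|` in three dimensions, for a system that is
orthonormal in the form `⟨u, |ξ| u⟩`. -/
theorem card_le_of_energy_le {ι : Type*} [Fintype ι] {φ h u : ι → L2R3}
    (hφ : Orthonormal ℂ φ) (hh : ∀ i, φ i =ᵐ[volume] fun ξ => (√‖ξ‖ : ℂ) * h i ξ)
    (hu : ∀ i, Lp.fourierTransformₗᵢ R3 ℂ (u i) = h i) {κ : ℝ} (hκ : 0 < κ) {W : R3 → ℝ}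
    (hW : Measurable W) (hW0 : ∀ x, 0 ≤ W x)
    (hE : ENNReal.ofReal κ * Fintype.card ι ≤ ∫⁻ x, ENNReal.ofReal (W x * ∑ i, ‖u i x‖ ^ 2)) :
    ENNReal.ofReal (κ ^ 3) * Fintype.card ι
      ≤ ENNReal.ofReal (8192 * lowFreqConst) * ∫⁻ x, ENNReal.ofReal (W x ^ 3) := by
  have hc := lowFreqConst_pos
  -- The choice `a = 16 / κ` makes `8 / a = κ / 2`, so half of the left side can be absorbed; `8192
  -- = 2 · 16 · 16²`.
  have h1 := hE.trans (lintegral_mul_density_le hφ hh hu (a := 16 / κ) (by positivity) hW hW0)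
  by_cases hI : ∫⁻ x, ENNReal.ofReal (W x ^ 3) = ⊤
  · rw [hI, ENNReal.mul_top (by simpa using hc)]
    exact le_top
  rw [← ENNReal.ofReal_toReal hI] at h1 ⊢
  set I := (∫⁻ x, ENNReal.ofReal (W x ^ 3)).toReal with hIdef
  have hI0 : 0 ≤ I := ENNReal.toReal_nonneg
  rw [← ENNReal.ofReal_natCast, ← ENNReal.ofReal_mul (by positivity),
    ← ENNReal.ofReal_mul (by positivity), ← ENNReal.ofReal_mul (by positivity),
    ← ENNReal.ofReal_add (by positivity) (by positivity),
    ENNReal.ofReal_le_ofReal_iff (by positivity)] at h1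
  rw [← ENNReal.ofReal_natCast, ← ENNReal.ofReal_mul (by positivity),
    ← ENNReal.ofReal_mul (by positivity)]
  refine ENNReal.ofReal_le_ofReal ?_
  have h2 := mul_le_mul_of_nonneg_left h1 (by positivity : 0 ≤ 2 * κ ^ 2)
  have h3 : 2 * κ ^ 2 * (8 / (16 / κ) * (Fintype.card ι : ℝ) + 16 * lowFreqConst * (16 / κ) ^ 2 * I)
      = κ ^ 3 * (Fintype.card ι : ℝ) + 8192 * lowFreqConst * I := by
    field_simp; ring
  rw [h3] at h2
  nlinarith

/-! ### Counting eigenvalues by orthonormal eigenvectors. -/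

theorem mem_eigenspaceOf_iff {T : L2R3 →ₗ.[ℂ] L2R3} {μ : ℝ} {u : L2R3} :
    u ∈ eigenspaceOf T μ ↔ ∃ hu : u ∈ T.domain, T ⟨u, hu⟩ = (μ : ℂ) • u := by
  constructor
  · rintro ⟨x, hx, rfl⟩
    refine ⟨x.2, ?_⟩
    have : (T.toFun - (μ : ℂ) • T.domain.subtype) x = 0 := hx
    exact sub_eq_zero.1 this
  · rintro ⟨hu, h⟩
    refine ⟨⟨u, hu⟩, ?_, rfl⟩
    exact sub_eq_zero.2 h

theorem inner_eq_zero_of_mem_eigenspaceOf {T : L2R3 →ₗ.[ℂ] L2R3} (hT : T.IsFormalAdjoint T)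
    {μ ν : ℝ} (h : μ ≠ ν) {u v : L2R3} (hu : u ∈ eigenspaceOf T μ) (hv : v ∈ eigenspaceOf T ν) :
    inner ℂ u v = 0 := by
  obtain ⟨hu1, hu2⟩ := mem_eigenspaceOf_iff.1 hu
  obtain ⟨hv1, hv2⟩ := mem_eigenspaceOf_iff.1 hv
  have key := hT ⟨u, hu1⟩ ⟨v, hv1⟩
  rw [hu2, hv2, inner_smul_left, inner_smul_right, Complex.conj_ofReal] at key
  by_contra h0
  exact h (Complex.ofReal_injective (mul_right_cancel₀ h0 key))

theorem exists_orthonormal_of_le_toENat_rank {M : Submodule ℂ L2R3} {n : ℕ}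
    (h : (n : ℕ∞) ≤ (Module.rank ℂ M).toENat) :
    ∃ w : Fin n → L2R3, Orthonormal ℂ w ∧ ∀ i, w i ∈ M := by
  obtain ⟨f, hf⟩ := Module.le_rank_iff.1 (Cardinal.natCast_le_toENat.1 h)
  refine ⟨fun i => (InnerProductSpace.gramSchmidtNormed ℂ f i : M), ?_, fun i => Subtype.mem _⟩
  exact (InnerProductSpace.gramSchmidtNormed_orthonormal hf).comp_linearIsometry M.subtypeₗᵢ

/-- To bound the number of eigenvalues of a symmetric operator below `E`, it suffices to bound the
length of orthonormal systems of eigenvectors. -/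
theorem eigenvalueCount_le {T : L2R3 →ₗ.[ℂ] L2R3} (hT : T.IsFormalAdjoint T) {E : ℝ} {B : ℝ≥0∞}
    (H : ∀ (ι : Type) [Fintype ι] (v : ι → L2R3) (μ : ι → ℝ), Orthonormal ℂ v → (∀ i, μ i < E) →
      (∀ i, v i ∈ eigenspaceOf T (μ i)) → (Fintype.card ι : ℝ≥0∞) ≤ B) :
    eigenvalueCount T E ≤ B := by
  refine ENNReal.summable.tsum_le_of_sum_le fun s => ?_
  set d : Iio E → ℕ∞ := fun μ => (Module.rank ℂ (eigenspaceOf T μ)).toENat with hd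
  -- Finite truncations `n` of the multiplicities also cover infinite ones: an infinite multiplicity
  -- admits every `m`, which forces `B = ⊤`.
  have claim : ∀ n : Iio E → ℕ, (∀ μ ∈ s, (n μ : ℕ∞) ≤ d μ) → ∑ μ ∈ s, (n μ : ℝ≥0∞) ≤ B := by
    intro n hn
    choose w hw hwm using fun μ : s => exists_orthonormal_of_le_toENat_rank (hn μ μ.2)
    have := H (Σ μ : s, Fin (n μ)) (fun p => w p.1 p.2) (fun p => (p.1 : Iio E)) ?_
      (fun p => (p.1 : Iio E).2) (fun p => hwm p.1 p.2)
    · rw [Fintype.card_sigma] at this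
      simpa [Finset.sum_attach s (fun μ => (n μ : ℝ≥0∞))] using this
    · refine ⟨fun p => (hw p.1).1 p.2, ?_⟩
      rintro ⟨μ, i⟩ ⟨ν, j⟩ hne
      by_cases h : μ = ν
      · subst h
        exact (hw μ).2 fun hij : i = j => hne (by rw [hij])
      · exact inner_eq_zero_of_mem_eigenspaceOf hT
          (fun h' => h (Subtype.ext (Subtype.ext h'))) (hwm μ i) (hwm ν j)
  by_cases htop : ∃ μ ∈ s, d μ = ⊤
  · obtain ⟨μ, hμ, hμt⟩ := htop
    have : B = ⊤ := by
      refine ENNReal.eq_top_of_forall_nnreal_le fun r => ?_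
      obtain ⟨m, hm⟩ := exists_nat_ge r
      have h1 := claim (fun ν => if ν = μ then m else 0) fun ν _ => by
        by_cases hν : ν = μ <;> simp [hν, hμt]
      rw [Finset.sum_eq_single_of_mem μ hμ fun ν _ hν => by simp [hν]] at h1
      simp only [if_true] at h1
      exact le_trans (by exact_mod_cast hm) h1
    simp [this]
  · push Not at htop
    have h1 := claim (fun μ => (d μ).toNat) fun μ hμ => by
      rw [ENat.natCast_toNat (htop μ hμ)]
    refine le_trans (Finset.sum_le_sum fun μ hμ => ?_) h1
    show ((d μ : ℕ∞) : ℝ≥0∞) ≤ _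
    conv_lhs => rw [← ENat.natCast_toNat (htop μ hμ)]
    simp

/-- A unit vector extends to a Hilbert basis, and `‖A e‖²` is then one term of the Hilbert-Schmidt
sum. -/
theorem norm_apply_le_of_hsNorm_le {A : L2R3 →L[ℂ] L2R3} {c : ℝ}
    (h : hsNorm A ≤ ENNReal.ofReal c) (hc : 0 ≤ c) (u : L2R3) : ‖A u‖ ≤ c * ‖u‖ := by
  have unit : ∀ e : L2R3, ‖e‖ = 1 → ‖A e‖ ≤ c := by
    intro e he
    have ho : Orthonormal ℂ ((↑) : ({e} : Set L2R3) → L2R3) := by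
      rw [orthonormal_subsingleton_iff]
      rintro ⟨x, rfl⟩
      exact he
    obtain ⟨w, b, hw, hb⟩ := ho.exists_hilbertBasis_extension
    have h1 : ‖A e‖ₑ ^ 2 ≤ ⨆ (w : Set L2R3) (b : HilbertBasis w ℂ L2R3), ∑' i, ‖A (b i)‖ₑ ^ 2 := by
      refine le_iSup_of_le w (le_iSup_of_le b ?_)
      refine le_trans ?_ (ENNReal.le_tsum ⟨e, hw rfl⟩)
      rw [hb]
    have h2 : ‖A e‖ₑ ≤ hsNorm A := by
      refine le_trans ?_ (ENNReal.rpow_le_rpow h1 (by norm_num : (0 : ℝ) ≤ 1 / 2))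
      rw [← ENNReal.rpow_natCast, ← ENNReal.rpow_mul]
      norm_num
    have h3 := h2.trans h
    rw [← ofReal_norm] at h3
    exact (ENNReal.ofReal_le_ofReal_iff hc).1 h3
  rcases eq_or_ne u 0 with rfl | hu
  · simp
  have hu' : 0 < ‖u‖ := norm_pos_iff.2 hu
  have := unit (((‖u‖⁻¹ : ℝ) : ℂ) • u) (by
    rw [norm_smul, Complex.norm_real, norm_inv, norm_norm, inv_mul_cancel₀ hu'.ne'])
  rw [map_smul, norm_smul, Complex.norm_real, norm_inv, norm_norm, inv_mul_le_iff₀ hu'] at this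
  rwa [mul_comm]

/-! ### Symmetry and quadratic form of the Hamiltonian. -/

theorem isFormalAdjoint_mulOp (g : R3 → ℝ) : (mulOp g).IsFormalAdjoint (mulOp g) := by
  intro x y
  rw [L2.inner_def, L2.inner_def]
  refine integral_congr_ae ?_
  filter_upwards [mulFun_coe g x, mulFun_coe g y] with ξ h1 h2
  have e1 : (mulOp g x : R3 → ℂ) ξ = (g ξ : ℂ) * (x : L2R3) ξ := h1
  have e2 : (mulOp g y : R3 → ℂ) ξ = (g ξ : ℂ) * (y : L2R3) ξ := h2
  rw [e1, e2, RCLike.inner_apply, RCLike.inner_apply, map_mul, Complex.conj_ofReal]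
  ring

theorem fourierMultiplier_apply (m : R3 → ℝ) (x : (fourierMultiplier m).domain) :
    fourierMultiplier m x = (Lp.fourierTransformₗᵢ R3 ℂ).symm
      (mulOp (fun ξ => m ((2 * Real.pi) • ξ)) ⟨Lp.fourierTransformₗᵢ R3 ℂ x, x.2⟩) := rfl

theorem isFormalAdjoint_fourierMultiplier (m : R3 → ℝ) :
    (fourierMultiplier m).IsFormalAdjoint (fourierMultiplier m) := by
  intro x y
  rw [fourierMultiplier_apply, fourierMultiplier_apply,
    ← (Lp.fourierTransformₗᵢ R3 ℂ).inner_map_map, LinearIsometryEquiv.apply_symm_apply,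
    ← (Lp.fourierTransformₗᵢ R3 ℂ).inner_map_map (x : L2R3), LinearIsometryEquiv.apply_symm_apply]
  exact isFormalAdjoint_mulOp _ ⟨_, x.2⟩ ⟨_, y.2⟩

theorem LinearPMap.IsFormalAdjoint.add_self {S T : L2R3 →ₗ.[ℂ] L2R3} (hS : S.IsFormalAdjoint S)
    (hT : T.IsFormalAdjoint T) : (S + T).IsFormalAdjoint (S + T) := by
  intro x y
  rw [LinearPMap.add_apply, LinearPMap.add_apply, inner_add_left, inner_add_right]
  exact congrArg₂ _ (hS ⟨x, x.2.1⟩ ⟨y, y.2.1⟩) (hT ⟨x, x.2.2⟩ ⟨y, y.2.2⟩)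

theorem isFormalAdjoint_hamiltonian (ℏ : ℝ) (V : R3 → ℝ) {A : L2R3 →L[ℂ] L2R3}
    (hA : IsSelfAdjoint A) : (hamiltonian ℏ V A).IsFormalAdjoint (hamiltonian ℏ V A) := by
  refine ((isFormalAdjoint_fourierMultiplier _).add_self (isFormalAdjoint_mulOp V)).add_self ?_
  intro x y
  exact (ContinuousLinearMap.isSelfAdjoint_iff_isSymmetric.1 hA) x y

theorem integrable_and_inner_mulOp (g : R3 → ℝ) (x : (mulOp g).domain) :
    Integrable (fun ξ => g ξ * ‖(x : L2R3) ξ‖ ^ 2) ∧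
    (inner ℂ (x : L2R3) (mulOp g x)).re = ∫ ξ, g ξ * ‖(x : L2R3) ξ‖ ^ 2 := by
  have e : (fun ξ => inner ℂ ((x : L2R3) ξ) ((mulOp g x : L2R3) ξ)) =ᵐ[volume]
      fun ξ => ((g ξ * ‖(x : L2R3) ξ‖ ^ 2 : ℝ) : ℂ) := by
    filter_upwards [mulFun_coe g x] with ξ h1
    have e1 : (mulOp g x : R3 → ℂ) ξ = (g ξ : ℂ) * (x : L2R3) ξ := h1
    rw [e1, RCLike.inner_apply, mul_assoc, Complex.mul_conj, Complex.normSq_eq_norm_sq]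
    push_cast
    rfl
  refine ⟨?_, ?_⟩
  · exact ((L2.integrable_inner (𝕜 := ℂ) (x : L2R3) (mulOp g x)).congr e).re
  · rw [L2.inner_def, integral_congr_ae e]
    exact congrArg Complex.re integral_ofReal

/-- Cauchy-Schwarz for `(c, b)` and `(q, 1)`, where `b = (1 + e)₊` and `c² + b² = 1`. -/
theorem mul_add_max_le_sqrt {e : ℝ} (he : e < 0) (q : ℝ) :
    √(1 - max (1 + e) 0 ^ 2) * q + (1 + e) ≤ √(1 + q ^ 2) := by
  set b := max (1 + e) 0
  have hb0 : 0 ≤ b := le_max_right _ _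
  have hb1 : b ≤ 1 := max_le (by linarith) zero_le_one
  have hbe : 1 + e ≤ b := le_max_left _ _
  have hs := Real.sq_sqrt (show 0 ≤ 1 - b ^ 2 by nlinarith)
  set c := √(1 - b ^ 2)
  refine (add_le_add_right hbe _).trans (Real.le_sqrt_of_sq_le ?_)
  nlinarith [sq_nonneg (b * q - c)]

theorem one_sub_max_sq_pos {e : ℝ} (he : e < 0) : 0 < 1 - max (1 + e) 0 ^ 2 := by
  have hb0 : 0 ≤ max (1 + e) 0 := le_max_right _ _
  have hb1 : max (1 + e) 0 < 1 := max_lt (by linarith) zero_lt_one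
  nlinarith

/-- The function `e ↦ 1 - (1 + e)₊²` is concave and vanishes at `0`. This trades the slope at `E₀/4`
for the one at `E₀/2` in the final constant. -/
theorem one_sub_max_sq_le_two_mul {e : ℝ} (he : e < 0) :
    1 - max (1 + 2 * e) 0 ^ 2 ≤ 2 * (1 - max (1 + e) 0 ^ 2) := by
  rcases le_total (1 + e) 0 with h | h
  · rw [max_eq_right h, max_eq_right (by linarith)]; norm_num
  rw [max_eq_left h]
  rcases le_total (1 + 2 * e) 0 with h' | h'
  · rw [max_eq_right h']; nlinarith
  · rw [max_eq_left h']; nlinarith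

/-- States of energy below `E₀` satisfy a form inequality between `|p|` and the potential well. -/
theorem energy_estimate {ℏ E₀ : ℝ} (hℏ : 0 < ℏ) (hE₀ : E₀ < 0) {V : R3 → ℝ} (hV : Measurable V)
    {A : L2R3 →L[ℂ] L2R3} (hA : ∀ u, ‖A u‖ ≤ -(E₀ / 4) * ‖u‖) {u : L2R3}
    (hu : u ∈ (hamiltonian ℏ V A).domain)
    (hE : (inner ℂ u (hamiltonian ℏ V A ⟨u, hu⟩)).re ≤ E₀ * ‖u‖ ^ 2) :
    Lp.fourierTransformₗᵢ R3 ℂ u ∈ mulDomain (fun ξ => √‖ξ‖) ∧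
    ENNReal.ofReal (2 * Real.pi * ℏ * √(1 - max (1 + E₀ / 4) 0 ^ 2)) *
        ∫⁻ ξ, ENNReal.ofReal ‖ξ‖ * ‖Lp.fourierTransformₗᵢ R3 ℂ u ξ‖ₑ ^ 2
      ≤ ∫⁻ x, ENNReal.ofReal (max (E₀ / 2 - V x) 0 * ‖u x‖ ^ 2) := by
  set h := Lp.fourierTransformₗᵢ R3 ℂ u with hh
  set κ := 2 * Real.pi * ℏ * √(1 - max (1 + E₀ / 4) 0 ^ 2) with hκ
  have hκ0 : 0 < κ := by
    have := Real.sqrt_pos.2 (one_sub_max_sq_pos (e := E₀ / 4) (by linarith))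
    positivity
  set m : R3 → ℝ := fun ξ => √(1 + ℏ ^ 2 * ‖(2 * Real.pi) • ξ‖ ^ 2) - 1 with hm
  have hnorm : ‖h‖ = ‖u‖ := LinearIsometryEquiv.norm_map _ _
  obtain ⟨⟨huk, huV⟩, -⟩ := id hu
  obtain ⟨hVi, hVe⟩ := integrable_and_inner_mulOp V ⟨u, huV⟩
  obtain ⟨hki, hke⟩ := integrable_and_inner_mulOp m ⟨h, huk⟩
  have hpt : ∀ ξ, κ * (‖ξ‖ * ‖h ξ‖ ^ 2) ≤ m ξ * ‖h ξ‖ ^ 2 + -(E₀ / 4) * ‖h ξ‖ ^ 2 := by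
    intro ξ
    have h1 := mul_add_max_le_sqrt (e := E₀ / 4) (by linarith) (ℏ * (2 * Real.pi * ‖ξ‖))
    have h2 : m ξ = √(1 + (ℏ * (2 * Real.pi * ‖ξ‖)) ^ 2) - 1 := by
      simp only [hm, norm_smul, Real.norm_eq_abs, abs_of_pos Real.two_pi_pos, mul_pow]
    have h3 : κ * ‖ξ‖ ≤ m ξ + -(E₀ / 4) := by
      rw [h2, hκ]; linarith
    rw [← mul_assoc, ← add_mul]
    exact mul_le_mul_of_nonneg_right h3 (sq_nonneg _)
  have hhm : AEStronglyMeasurable (h : R3 → ℂ) volume := Lp.aestronglyMeasurable h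
  have hui : Integrable fun x => ‖u x‖ ^ 2 := integrable_norm_sq u
  have hhi : Integrable fun x => ‖h x‖ ^ 2 := integrable_norm_sq h
  have hri : Integrable fun ξ => m ξ * ‖h ξ‖ ^ 2 + -(E₀ / 4) * ‖h ξ‖ ^ 2 :=
    hki.add (hhi.const_mul _)
  -- Membership in the operator domain makes the majorant integrable, so `u` has finite
  -- `|ξ|`-energy.
  have hκi : Integrable fun ξ => κ * (‖ξ‖ * ‖h ξ‖ ^ 2) := by
    refine hri.mono' (by fun_prop) (Filter.Eventually.of_forall fun ξ => ?_)
    rw [Real.norm_of_nonneg (by positivity)]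
    exact hpt ξ
  have hi : Integrable fun ξ => ‖ξ‖ * ‖h ξ‖ ^ 2 := by
    simpa [← mul_assoc, hκ0.ne'] using hκi.const_mul κ⁻¹
  refine ⟨?_, ?_⟩
  · show MemLp (fun ξ => ((√‖ξ‖ : ℝ) : ℂ) * h ξ) 2 volume
    rw [memLp_two_iff_integrable_sq_norm]
    · refine hi.congr (Filter.Eventually.of_forall fun ξ => ?_)
      simp only [norm_mul, Complex.norm_real, mul_pow, Real.norm_eq_abs, sq_abs,
        Real.sq_sqrt (norm_nonneg _)]
    · refine AEStronglyMeasurable.mul ?_ hhm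
      exact (Complex.continuous_ofReal.comp (by fun_prop)).aestronglyMeasurable
  have hWi : Integrable fun x => max (E₀ / 2 - V x) 0 * ‖u x‖ ^ 2 := by
    refine ((hui.const_mul (E₀ / 2)).sub hVi).norm.mono' (by fun_prop)
      (Filter.Eventually.of_forall fun x => ?_)
    rw [Pi.sub_apply, ← sub_mul, norm_mul, norm_mul]
    refine mul_le_mul_of_nonneg_right ?_ (norm_nonneg _)
    rw [Real.norm_of_nonneg (le_max_right _ _)]
    exact max_le (Real.le_norm_self _) (norm_nonneg _)
  have hreal : κ * ∫ ξ, ‖ξ‖ * ‖h ξ‖ ^ 2 ≤ ∫ x, max (E₀ / 2 - V x) 0 * ‖u x‖ ^ 2 := by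
    have h1 : κ * ∫ ξ, ‖ξ‖ * ‖h ξ‖ ^ 2
        ≤ (∫ ξ, m ξ * ‖h ξ‖ ^ 2) + -(E₀ / 4) * ‖u‖ ^ 2 := by
      rw [← hnorm, norm_sq_eq_integral h, ← integral_const_mul, ← integral_const_mul,
        ← integral_add hki (hhi.const_mul _)]
      exact integral_mono hκi hri hpt
    have h2 : E₀ / 2 * ‖u‖ ^ 2 - ∫ x, V x * ‖u x‖ ^ 2
        ≤ ∫ x, max (E₀ / 2 - V x) 0 * ‖u x‖ ^ 2 := by
      rw [norm_sq_eq_integral u, ← integral_const_mul, ← integral_sub (hui.const_mul _) hVi]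
      refine integral_mono ((hui.const_mul _).sub hVi) hWi fun x => ?_
      simp only [← sub_mul]
      exact mul_le_mul_of_nonneg_right (le_max_left _ _) (sq_nonneg _)
    -- From `E₀`, the operator `A` and the line below the kinetic energy each take away `E₀/4`;
    -- `E₀/2` remains.
    have h3 : -(-(E₀ / 4) * ‖u‖ ^ 2) ≤ (inner ℂ u (A u)).re := by
      have h4 := (Complex.abs_re_le_norm _).trans (norm_inner_le_norm u (A u))
      have h5 := (abs_le.1 h4).1
      have h6 := mul_le_mul_of_nonneg_left (hA u) (norm_nonneg u)
      nlinarith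
    have h4 : (inner ℂ u (hamiltonian ℏ V A ⟨u, hu⟩)).re
        = (∫ ξ, m ξ * ‖h ξ‖ ^ 2) + (∫ x, V x * ‖u x‖ ^ 2) + (inner ℂ u (A u)).re := by
      have e1 : hamiltonian ℏ V A ⟨u, hu⟩
          = (Lp.fourierTransformₗᵢ R3 ℂ).symm (mulOp m ⟨h, huk⟩) + mulOp V ⟨u, huV⟩ + A u := rfl
      have e2 : inner ℂ u ((Lp.fourierTransformₗᵢ R3 ℂ).symm (mulOp m ⟨h, huk⟩))
          = inner ℂ h (mulOp m ⟨h, huk⟩) := by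
        rw [← (Lp.fourierTransformₗᵢ R3 ℂ).inner_map_map, LinearIsometryEquiv.apply_symm_apply]
      rw [e1, inner_add_right, inner_add_right, e2, Complex.add_re, Complex.add_re, hke, hVe]
    linarith
  have e : ∀ ξ, ENNReal.ofReal ‖ξ‖ * ‖h ξ‖ₑ ^ 2 = ENNReal.ofReal (‖ξ‖ * ‖h ξ‖ ^ 2) := by
    intro ξ
    rw [ENNReal.ofReal_mul (norm_nonneg _), ENNReal.ofReal_pow (norm_nonneg _), ofReal_norm (h ξ)]
  simp_rw [e]
  rw [← ofReal_integral_eq_lintegral_ofReal hi (Filter.Eventually.of_forall fun ξ => by positivity),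
    ← ofReal_integral_eq_lintegral_ofReal hWi (Filter.Eventually.of_forall fun x => by positivity),
    ← ENNReal.ofReal_mul hκ0.le]
  exact ENNReal.ofReal_le_ofReal hreal

/-- In the orthonormal eigenbasis the form is the diagonal sum `∑ μᵢ |cᵢ|²`. -/
theorem energy_le_of_mem_span {T : L2R3 →ₗ.[ℂ] L2R3} {ι : Type*} [Fintype ι] {v : ι → L2R3}
    {μ : ι → ℝ} {E : ℝ} (hv : Orthonormal ℂ v) (hμ : ∀ i, μ i ≤ E)
    (hT : ∀ i, v i ∈ eigenspaceOf T (μ i)) {u : L2R3} (hu : u ∈ Submodule.span ℂ (range v)) :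
    ∃ hu' : u ∈ T.domain, (inner ℂ u (T ⟨u, hu'⟩)).re ≤ E * ‖u‖ ^ 2 := by
  choose hd hTv using fun i => mem_eigenspaceOf_iff.1 (hT i)
  obtain ⟨c, rfl⟩ := (Submodule.mem_span_range_iff_exists_fun ℂ).1 hu
  have hmem : ∑ i, c i • v i ∈ T.domain :=
    Submodule.sum_mem _ fun i _ => T.domain.smul_mem _ (hd i)
  refine ⟨hmem, ?_⟩
  have e1 : (⟨∑ i, c i • v i, hmem⟩ : T.domain) = ∑ i, c i • ⟨v i, hd i⟩ :=
    Subtype.ext (by simp)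
  have e2 : T ⟨∑ i, c i • v i, hmem⟩ = ∑ i, (c i * (μ i : ℂ)) • v i := by
    rw [e1]
    show T.toFun _ = _
    rw [map_sum]
    refine Finset.sum_congr rfl fun i _ => ?_
    rw [map_smul, mul_smul, ← hTv i]
    rfl
  have e3 : ‖∑ i, c i • v i‖ ^ 2 = ∑ i, ‖c i‖ ^ 2 := by
    have := inner_self_eq_norm_sq_to_K (𝕜 := ℂ) (∑ i, c i • v i)
    rw [hv.inner_sum] at this
    simp only [RCLike.conj_mul] at this
    exact_mod_cast this.symm
  rw [e2, e3, hv.inner_sum, Complex.re_sum, Finset.mul_sum]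
  refine Finset.sum_le_sum fun i _ => ?_
  rw [← mul_assoc, Complex.conj_mul', ← Complex.ofReal_pow, ← Complex.ofReal_mul, Complex.ofReal_re,
    mul_comm]
  exact mul_le_mul_of_nonneg_right (hμ i) (sq_nonneg _)

/-! ### From form inequalities to dimension, and the conclusion. -/

/-- The Cwikel-Lieb-Rozenblum inequality for `|p|` in three dimensions, in terms of the dimension
of a space on which the quadratic form `κ |ξ| - W` is nonpositive. -/
theorem finrank_le_of_energy_le (S : Submodule ℂ L2R3) [FiniteDimensional ℂ S] {κ : ℝ}
    (hκ : 0 < κ) {W : R3 → ℝ} (hW : Measurable W) (hW0 : ∀ x, 0 ≤ W x)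
    (hS : ∀ u ∈ S, Lp.fourierTransformₗᵢ R3 ℂ u ∈ mulDomain (fun ξ => √‖ξ‖) ∧
      ENNReal.ofReal κ * ∫⁻ ξ, ENNReal.ofReal ‖ξ‖ * ‖Lp.fourierTransformₗᵢ R3 ℂ u ξ‖ₑ ^ 2
        ≤ ∫⁻ x, ENNReal.ofReal (W x * ‖u x‖ ^ 2)) :
    ENNReal.ofReal (κ ^ 3) * Module.finrank ℂ S
      ≤ ENNReal.ofReal (8192 * lowFreqConst) * ∫⁻ x, ENNReal.ofReal (W x ^ 3) := by
  let L : S →ₗ[ℂ] L2R3 := (mulOp fun ξ => √‖ξ‖).toFun ∘ₗ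
    ((Lp.fourierTransformₗᵢ R3 ℂ).toLinearEquiv.toLinearMap ∘ₗ S.subtype).codRestrict
      (mulDomain fun ξ => √‖ξ‖) (fun u => (hS u u.2).1)
  have hL : ∀ u : S, L u =ᵐ[volume]
      fun ξ => (√‖ξ‖ : ℂ) * (Lp.fourierTransformₗᵢ R3 ℂ (u : L2R3) : L2R3) ξ :=
    fun u => mulFun_coe (fun ξ => √‖ξ‖) ⟨Lp.fourierTransformₗᵢ R3 ℂ (u : L2R3), (hS u u.2).1⟩
  have hinj : Function.Injective L := by
    rw [injective_iff_map_eq_zero]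
    intro u hu
    have h0 : (Lp.fourierTransformₗᵢ R3 ℂ (u : L2R3) : L2R3) = 0 := by
      rw [Lp.eq_zero_iff_ae_eq_zero]
      have h1 := hL u
      rw [hu] at h1
      have h2 : ∀ᵐ ξ : R3, ξ ≠ 0 := by simp [ae_iff]
      filter_upwards [h1, h2, Lp.coeFn_zero ℂ 2 (volume : Measure R3)] with ξ a1 a2 a3
      rw [a3] at a1
      have a4 : ((√‖ξ‖ : ℝ) : ℂ) ≠ 0 := by simpa using a2
      exact (mul_eq_zero.1 a1.symm).resolve_left a4
    exact Subtype.ext ((LinearIsometryEquiv.map_eq_zero_iff _).1 h0)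
  have hfin : Module.finrank ℂ (LinearMap.range L) = Module.finrank ℂ S :=
    LinearMap.finrank_range_of_inj hinj
  -- Orthonormalizing in the range of `L` and pulling back gives functions orthonormal for `⟨u, |ξ|
  -- u⟩`; injectivity of `L` preserves the dimension.
  let b := stdOrthonormalBasis ℂ (LinearMap.range L)
  have hb : Orthonormal ℂ fun i => (b i : L2R3) :=
    b.orthonormal.comp_linearIsometry (LinearMap.range L).subtypeₗᵢ
  choose u hu using fun i => LinearMap.mem_range.1 (b i).2
  have hh : ∀ i, (b i : L2R3) =ᵐ[volume]
      fun ξ => (√‖ξ‖ : ℂ) * (Lp.fourierTransformₗᵢ R3 ℂ (u i : L2R3) : L2R3) ξ := by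
    intro i
    rw [← hu i]
    exact hL (u i)
  have := card_le_of_energy_le hb hh (fun i => rfl) hκ hW hW0 ?_
  · simpa [hfin] using this
  · rw [← sum_lintegral_norm_mul_enorm_sq hb hh, Finset.mul_sum]
    refine (Finset.sum_le_sum fun i _ => (hS (u i) (u i).2).2).trans_eq ?_
    rw [← lintegral_finsetSum _ fun i _ => ?_]
    · refine lintegral_congr fun x => ?_
      rw [Finset.mul_sum, ENNReal.ofReal_sum_of_nonneg fun i _ => mul_nonneg (hW0 x) (sq_nonneg _)]
    · exact (hW.mul ((Lp.stronglyMeasurable _).measurable.norm.pow_const 2)).ennreal_ofReal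

theorem countingN_le {ℏ E₀ E : ℝ} (hℏ : 0 < ℏ) (hE₀ : E₀ < 0) (hE : E ≤ E₀) {V : R3 → ℝ}
    (hV : Measurable V) {A : L2R3 →L[ℂ] L2R3} (hAs : IsSelfAdjoint A)
    (hA : ∀ u, ‖A u‖ ≤ -(E₀ / 4) * ‖u‖) :
    ENNReal.ofReal ((2 * Real.pi * ℏ) ^ 3) * countingN ℏ V A E ≤
      ENNReal.ofReal (8192 * lowFreqConst / √(1 - max (1 + E₀ / 4) 0 ^ 2) ^ 3) *
        ∫⁻ x, ENNReal.ofReal (max (E₀ / 2 - V x) 0 ^ 3) := by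
  have hs := Real.sqrt_pos.2 (one_sub_max_sq_pos (e := E₀ / 4) (by linarith))
  have hc := lowFreqConst_pos
  have hpi := Real.pi_pos
  have hW : Measurable fun x => max (E₀ / 2 - V x) 0 := (hV.const_sub _).max measurable_const
  set s := √(1 - max (1 + E₀ / 4) 0 ^ 2)
  set I := ∫⁻ x, ENNReal.ofReal (max (E₀ / 2 - V x) 0 ^ 3)
  have hκ : 0 < 2 * Real.pi * ℏ * s := by positivity
  have key : countingN ℏ V A E
      ≤ ENNReal.ofReal (8192 * lowFreqConst / (2 * Real.pi * ℏ * s) ^ 3) * I := by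
    refine eigenvalueCount_le (isFormalAdjoint_hamiltonian ℏ V hAs) fun ι _ v μ hv hμ hT => ?_
    have : FiniteDimensional ℂ (Submodule.span ℂ (range v)) :=
      FiniteDimensional.span_of_finite ℂ (finite_range v)
    have h1 := finrank_le_of_energy_le (Submodule.span ℂ (range v)) hκ hW
      (fun x => le_max_right _ _) fun u hu => by
        obtain ⟨hu1, hu2⟩ := energy_le_of_mem_span hv (fun i => ((hμ i).trans_le hE).le) hT hu
        exact energy_estimate hℏ hE₀ hV hA hu1 hu2
    rw [finrank_span_eq_card hv.linearIndependent] at h1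
    calc (Fintype.card ι : ℝ≥0∞) = ENNReal.ofReal (((2 * Real.pi * ℏ * s) ^ 3)⁻¹) *
          (ENNReal.ofReal ((2 * Real.pi * ℏ * s) ^ 3) * Fintype.card ι) := by
          rw [← mul_assoc, ← ENNReal.ofReal_mul (by positivity), inv_mul_cancel₀ (by positivity)]
          simp
      _ ≤ ENNReal.ofReal (((2 * Real.pi * ℏ * s) ^ 3)⁻¹) *
          (ENNReal.ofReal (8192 * lowFreqConst) * I) := by gcongr
      _ = _ := by
          rw [← mul_assoc, ← ENNReal.ofReal_mul (by positivity), inv_mul_eq_div]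
  refine (mul_le_mul_right key _).trans_eq ?_
  rw [← mul_assoc, ← ENNReal.ofReal_mul (by positivity)]
  congr 2
  field_simp

theorem eLpNorm_three_pow_three {W : R3 → ℝ} (hW0 : ∀ x, 0 ≤ W x) :
    eLpNorm W 3 volume ^ 3 = ∫⁻ x, ENNReal.ofReal (W x ^ 3) := by
  rw [eLpNorm_eq_lintegral_rpow_enorm_toReal (by norm_num) (by norm_num), ← ENNReal.rpow_natCast,
    ← ENNReal.rpow_mul]
  simp [ENNReal.ofReal_pow (hW0 _), Real.enorm_eq_ofReal (hW0 _)]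

theorem mainTheorem10 :
    ∃ C : ℝ, 0 < C ∧ ∀ K : ℝ, 0 < K → ∀ E₀ : ℝ, E₀ < 0 →
      ∃ ℏ₀ ∈ Ioc (0 : ℝ) 1,
        ∀ (V : ℝ → R3 → ℝ) (A : ℝ → L2R3 →L[ℂ] L2R3), WeylAssumption K V A →
          ∀ ℏ ∈ Ioc (0 : ℝ) ℏ₀, ∀ E ≤ E₀,
            ENNReal.ofReal ((2 * Real.pi * ℏ) ^ 3) * countingN ℏ (V ℏ) (A ℏ) E ≤
              ENNReal.ofReal (C / (1 - max (1 + E₀ / 2) 0 ^ 2) ^ (3 / 2 : ℝ)) *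
                eLpNorm (fun x => max (E₀ / 2 - V ℏ x) 0) 3 volume ^ 3 := by
  have hc := lowFreqConst_pos
  -- The factor `2^(3/2)` pays for passing from `E₀/4` to `E₀/2` in the denominator.
  refine ⟨8192 * lowFreqConst * 2 ^ (3 / 2 : ℝ), by positivity, fun K hK E₀ hE₀ => ?_⟩
  have hδ : 0 < -(E₀ / 4) / K := div_pos (by linarith) hK
  -- This `ℏ₀` is what makes `K √ℏ ≤ |E₀|/4`.
  refine ⟨min 1 ((-(E₀ / 4) / K) ^ 2), ⟨by positivity, min_le_left _ _⟩, ?_⟩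
  intro V A hVA ℏ hℏ E hE
  have hℏ1 : ℏ ∈ Ioc (0 : ℝ) 1 := ⟨hℏ.1, hℏ.2.trans (min_le_left _ _)⟩
  have hsqrt : K * √ℏ ≤ -(E₀ / 4) := by
    rw [← le_div_iff₀' hK]
    exact (Real.sqrt_le_left hδ.le).2 (hℏ.2.trans (min_le_right _ _))
  have hA : ∀ u, ‖A ℏ u‖ ≤ -(E₀ / 4) * ‖u‖ := fun u =>
    (norm_apply_le_of_hsNorm_le (hVA.hsNorm_le ℏ hℏ1) (mul_nonneg hK.le (Real.sqrt_nonneg _)) u).trans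
      (mul_le_mul_of_nonneg_right hsqrt (norm_nonneg _))
  refine le_trans (countingN_le hℏ.1 hE₀ hE (hVA.contDiff ℏ hℏ1).continuous.measurable
    (hVA.selfAdjoint ℏ hℏ1) hA) ?_
  rw [eLpNorm_three_pow_three fun x => le_max_right (E₀ / 2 - V ℏ x) 0]
  gcongr ENNReal.ofReal ?_ * _
  have hd := one_sub_max_sq_pos (e := E₀ / 2) (by linarith)
  have ht := one_sub_max_sq_pos (e := E₀ / 4) (by linarith)
  have hdt := one_sub_max_sq_le_two_mul (e := E₀ / 4) (by linarith)
  rw [show 2 * (E₀ / 4) = E₀ / 2 by ring] at hdt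
  set d := 1 - max (1 + E₀ / 2) 0 ^ 2
  set t := 1 - max (1 + E₀ / 4) 0 ^ 2
  have e : √t ^ 3 = t ^ (3 / 2 : ℝ) := by
    rw [Real.sqrt_eq_rpow, ← Real.rpow_natCast, ← Real.rpow_mul ht.le]
    norm_num
  rw [e, div_le_div_iff₀ (by positivity) (by positivity), mul_assoc (8192 * lowFreqConst)]
  refine mul_le_mul_of_nonneg_left ?_ (by positivity)
  rw [← Real.mul_rpow (by norm_num) ht.le]
  exact Real.rpow_le_rpow hd.le hdt (by norm_num)
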